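/- Let $\mathcal D$ be a set of datasets. A mechanism $\mathcal M$ with values in a measurable space $\mathcal O$ assigns to each $D\in\mathcal D$ a probability distribution $\mathcal M(D)$ on $\mathcal O$. A privacy definition $\mathrm{Def}$ (a property of mechanisms) satisfies the *post-processing axiom* if, for every mechanism $\mathcal M$ satisfying $\mathrm{Def}$ and every probabilistic function (Markov kernel) $\kappa$ from $\mathcal O$ to a measurable space $\mathcal O'$, the mechanism $D\mapsto\kappa(\mathcal M(D))$ satisfies $\mathrm{Def}$. It satisfies the *convexity axiom* if, for all mechanisms $\mathcal M_1,\mathcal M_2$ with values in the same space $\mathcal O$ that satisfy $\mathrm{Def}$ and every $p\in[0,1]$, the mechanism that equals $\mathcal M_1(D)$ with probability $p$ and $\mathcal M_2(D)$ with probability $1-p$ satisfies $\mathrm{Def}$. Let $d_{\mathcal D}:\mathcal D^2\to[-\infty,\infty]$ be an arbitrary function. 1. A mechanism $\mathcal M$ satisfies $d_{\mathcal D}$-privacy if $\Pr[\mathcal M(D_1)\in S]\le e^{d_{\mathcal D}(D_1,D_2)}\cdot\Pr[\mathcal M(D_2)\in S]$ for all $D_1,D_2\in\mathcal D$ and all measurable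 $S\subseteq\mathcal O$ (no condition is imposed on pairs with $d_{\mathcal D}(D_1,D_2)=\infty$). Then $d_{\mathcal D}$-privacy satisfies both the post-processing axiom and the convexity axiom. 2. Let $f:(0,\infty)\to\mathbb R$ be any convex function with $f(1)=0$, put $f(0)=\lim_{t\to0^+}f(t)$ and $f'(\infty)=\lim_{t\to\infty}f(t)/t$ (both in $(-\infty,\infty]$), and let $$D_f(\mu\,\|\,\nu)=\int f\Big(\frac{d\mu_a}{d\nu}\Big)\,d\nu+f'(\infty)\,\mu_s(\mathcal O)$$ be the $f$-divergence of probability distributions on $\mathcal O$, where $\mu=\mu_a+\mu_s$ is the Lebesgue decomposition of $\mu$ with respect to $\nu$ and $\infty\cdot0=0$. A mechanism $\mathcal M$ satisfies extended divergence differential privacy (with parameters $f$ and $d_{\mathcal D}$) if $D_f(\mathcal M(D_1)\,\|\,\mathcal M(D_2))\le d_{\mathcal D}(D_1,D_2)$ for all $D_1,D_2\in\mathcal D$. Then extended divergence differential privacy satisfies both the post-processing axiom and the convexity axiom. -/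

import Mathlib

open MeasureTheory ProbabilityTheory Filter Topology Set
open scoped ENNReal

universe u v

noncomputable section

namespace Privacy

/-- A privacy mechanism on the set `𝒟` of datasets with outputs in the measurable space `O`: to each
dataset it assigns a probability distribution on the outputs. -/
abbrev Mechanism (𝒟 O : Type*) [MeasurableSpace O] := 𝒟 → ProbabilityMeasure O

/-- A privacy definition for datasets in `𝒟`: a property of mechanisms, for all output spaces. -/
abbrev PrivacyDef (𝒟 : Type v) :=
  ∀ (O : Type u) [MeasurableSpace O], Mechanism 𝒟 O → Prop

/-- The mechanism `D ↦ κ (M D)`, for a probabilistic function (Markov kernel) `κ`. -/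
def postProcess {𝒟 O O' : Type*} [MeasurableSpace O] [MeasurableSpace O']
    (κ : Kernel O O') [IsMarkovKernel κ] (M : Mechanism 𝒟 O) : Mechanism 𝒟 O' :=
  fun D => ⟨κ ∘ₘ (M D : Measure O), inferInstance⟩

theorem isProbabilityMeasure_mix {O : Type*} [MeasurableSpace O] {p : ℝ} (hp : p ∈ Icc (0 : ℝ) 1)
    (μ ν : Measure O) [IsProbabilityMeasure μ] [IsProbabilityMeasure ν] :
    IsProbabilityMeasure (ENNReal.ofReal p • μ + ENNReal.ofReal (1 - p) • ν) := by
  refine ⟨?_⟩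
  simp [← ENNReal.ofReal_add hp.1 (sub_nonneg.2 hp.2)]

/-- The mechanism that runs `M₁` with probability `p` and `M₂` with probability `1 - p`. -/
def mix {𝒟 O : Type*} [MeasurableSpace O] (p : ℝ) (hp : p ∈ Icc (0 : ℝ) 1)
    (M₁ M₂ : Mechanism 𝒟 O) : Mechanism 𝒟 O :=
  fun D => ⟨ENNReal.ofReal p • (M₁ D : Measure O) + ENNReal.ofReal (1 - p) • (M₂ D : Measure O),
    isProbabilityMeasure_mix hp _ _⟩

/-- The post-processing axiom. -/
def PostProcessingAxiom {𝒟 : Type v} (Def : PrivacyDef.{u, v} 𝒟) : Prop :=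
  ∀ (O O' : Type u) [MeasurableSpace O] [MeasurableSpace O'] (M : Mechanism 𝒟 O)
    (κ : Kernel O O') [IsMarkovKernel κ], Def O M → Def O' (postProcess κ M)

/-- The convexity axiom (privacy axiom of choice). -/
def ConvexityAxiom {𝒟 : Type v} (Def : PrivacyDef.{u, v} 𝒟) : Prop :=
  ∀ (O : Type u) [MeasurableSpace O] (M₁ M₂ : Mechanism 𝒟 O) (p : ℝ) (hp : p ∈ Icc (0 : ℝ) 1),
    Def O M₁ → Def O M₂ → Def O (mix p hp M₁ M₂)

/-- `d`-privacy: `ℙ[M D₁ ∈ S] ≤ e ^ d(D₁, D₂) * ℙ[M D₂ ∈ S]` for all pairs of datasets and all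
measurable sets of outputs. A pair at distance `+∞` is not constrained; this is said explicitly
since `∞ * 0 = 0` in `ℝ≥0∞`. -/
def DPrivacy {𝒟 : Type v} (d : 𝒟 → 𝒟 → EReal) : PrivacyDef.{u, v} 𝒟 :=
  fun O _ M => ∀ D₁ D₂ : 𝒟, d D₁ D₂ ≠ ⊤ → ∀ S : Set O, MeasurableSet S →
    (M D₁ : Measure O) S ≤ EReal.exp (d D₁ D₂) * (M D₂ : Measure O) S

/-- A convex function `f` on `(0, ∞)`, extended to `0` by its limit from the right, which may be
`+∞` (the limit exists by convexity, so it is the upper limit). The value at `∞` plays no role. -/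
def extendZero (f : ℝ → ℝ) (t : ℝ≥0∞) : EReal :=
  if t = 0 then limsup (fun s : ℝ => (f s : EReal)) (𝓝[>] 0) else (f t.toReal : EReal)

/-- `f'(∞) = lim_{s → ∞} f(s) / s` in `(-∞, ∞]` (the limit exists by convexity). -/
def slopeAtTop (f : ℝ → ℝ) : EReal :=
  limsup (fun s : ℝ => ((f s / s : ℝ) : EReal)) atTop

/-- The `f`-divergence `D_f(μ ‖ ν) = ∫ f(dμ/dν) dν + f'(∞) * μₛ(O)`, where `dμ/dν` is the density of
the absolutely continuous part of `μ` and `μₛ` is the part of `μ` that is singular to `ν`.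
The integral is that of the positive part minus that of the negative part; for convex `f` and
finite measures the latter is finite and `f'(∞) ≠ -∞`, so the expression is meaningful. -/
def fDiv {O : Type*} [MeasurableSpace O] (f : ℝ → ℝ) (μ ν : Measure O) : EReal :=
  ((∫⁻ x, (extendZero f (μ.rnDeriv ν x)).toENNReal ∂ν : ℝ≥0∞) : EReal)
    - ((∫⁻ x, (-extendZero f (μ.rnDeriv ν x)).toENNReal ∂ν : ℝ≥0∞) : EReal)
    + slopeAtTop f * ((μ.singularPart ν univ : ℝ≥0∞) : EReal)

/-- Extended divergence differential privacy: `D_f(M D₁ ‖ M D₂) ≤ d(D₁, D₂)` for all pairs of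
datasets. -/
def ExtendedDivergenceDP {𝒟 : Type v} (f : ℝ → ℝ) (d : 𝒟 → 𝒟 → EReal) :
    PrivacyDef.{u, v} 𝒟 :=
  fun O _ M => ∀ D₁ D₂ : 𝒟, fDiv f (M D₁ : Measure O) (M D₂ : Measure O) ≤ d D₁ D₂

end Privacy

end

/-! The divergence part rests on a variational formula. A convex `f` is the supremum of its affine
minorants `t ↦ a * t + b`, with `f(0)` the supremum of the intercepts and `f'(∞)` that of the
slopes. Choosing a minorant at each point, boundedly and measurably, gives `D_f(μ ‖ ν) = sup (∫ a dμ
+ ∫ b dν)` over all such fields `(a, b)` (`IsMinorantField.le_fDiv`,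
`fDiv_le_of_forall_isMinorantField`). Each term is linear in `(μ, ν)`, so bounds survive mixing
(`fDiv_mix_le`). Averaging a field over a Markov kernel gives another field, so kernels cannot
increase the supremum (`fDiv_comp_le`).

For `d`-privacy the condition is an inequality `M D₁ ≤ e ^ d • M D₂` of measures, which kernels and
mixtures preserve. -/

namespace Privacy

/-! ### Affine minorants of a convex function -/

/-- The affine function `t ↦ p.1 * t + p.2` lies below `f` on `(0, ∞)`. -/
def IsAffineMinorant (f : ℝ → ℝ) (p : ℝ × ℝ) : Prop :=
  ∀ t, 0 < t → p.1 * t + p.2 ≤ f t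

theorem exists_isAffineMinorant_eq {f : ℝ → ℝ} (hf : ConvexOn ℝ (Ioi 0) f) {s : ℝ} (hs : 0 < s) :
    ∃ p, IsAffineMinorant f p ∧ p.1 * s + p.2 = f s := by
  have hs' : s ∈ interior (Ioi (0 : ℝ)) := by simpa using hs
  refine ⟨(derivWithin f (Ioi s) s, f s - derivWithin f (Ioi s) s * s), fun t ht => ?_, by simp⟩
  rcases lt_trichotomy s t with h | rfl | h
  · have := hf.rightDeriv_le_slope_of_mem_interior hs' ht h
    rw [slope_def_field, le_div_iff₀ (sub_pos.2 h)] at this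
    dsimp only
    linarith
  · simp
  · have := (hf.slope_le_leftDeriv_of_mem_interior ht hs' h).trans
      (hf.leftDeriv_le_rightDeriv_of_mem_interior hs')
    rw [slope_def_field, div_le_iff₀ (sub_pos.2 h)] at this
    dsimp only
    linarith

theorem IsAffineMinorant.mono {f : ℝ → ℝ} {p q : ℝ × ℝ} (hp : IsAffineMinorant f p)
    (h₁ : q.1 ≤ p.1) (h₂ : q.2 ≤ p.2) : IsAffineMinorant f q := fun t ht =>
  (add_le_add (mul_le_mul_of_nonneg_right h₁ ht.le) h₂).trans (hp t ht)

theorem IsAffineMinorant.le_extendZero {f : ℝ → ℝ} {p : ℝ × ℝ} (hp : IsAffineMinorant f p)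
    {t : ℝ≥0∞} (ht : t ≠ ∞) :
    ((p.1 * t.toReal + p.2 : ℝ) : EReal) ≤ extendZero f t := by
  unfold extendZero
  split_ifs with h
  · have hlim : Tendsto (fun s : ℝ => ((p.1 * s + p.2 : ℝ) : EReal)) (𝓝[>] 0)
        (𝓝 ((p.1 * 0 + p.2 : ℝ) : EReal)) :=
      (continuous_coe_real_ereal.tendsto _).comp
        ((Continuous.tendsto (by fun_prop) 0).mono_left nhdsWithin_le_nhds)
    rw [h, ENNReal.toReal_zero, ← hlim.limsup_eq]
    refine limsup_le_limsup ?_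
    filter_upwards [self_mem_nhdsWithin] with s hs
    exact EReal.coe_le_coe_iff.2 (hp s hs)
  · exact EReal.coe_le_coe_iff.2 (hp _ (ENNReal.toReal_pos h ht))

theorem IsAffineMinorant.le_slopeAtTop {f : ℝ → ℝ} {p : ℝ × ℝ} (hp : IsAffineMinorant f p) :
    (p.1 : EReal) ≤ slopeAtTop f := by
  have hlim : Tendsto (fun s : ℝ => ((p.1 + p.2 * s⁻¹ : ℝ) : EReal)) atTop
      (𝓝 ((p.1 + p.2 * 0 : ℝ) : EReal)) :=
    (continuous_coe_real_ereal.tendsto _).comp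
      (tendsto_const_nhds.add (tendsto_inv_atTop_zero.const_mul _))
  rw [mul_zero, add_zero] at hlim
  rw [slopeAtTop, ← hlim.limsup_eq]
  refine limsup_le_limsup ?_
  filter_upwards [eventually_gt_atTop 0] with s hs
  rw [EReal.coe_le_coe_iff, le_div_iff₀ hs]
  have := hp s hs
  field_simp
  linarith

/-- Lowering both coefficients keeps a minorant, because `t > 0`; rational coefficients slightly
below `p` therefore work, and countably many minorants suffice. -/
theorem exists_isAffineMinorant_rat_lt {f : ℝ → ℝ} {p : ℝ × ℝ} (hp : IsAffineMinorant f p)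
    {u v c : ℝ} (h : c < p.1 * u + p.2 * v) :
    ∃ q : ℚ × ℚ, IsAffineMinorant f (q.1, q.2) ∧ c < q.1 * u + q.2 * v := by
  have hlim : Tendsto (fun w : ℝ × ℝ => w.1 * u + w.2 * v) (𝓝[<] p.1 ×ˢ 𝓝[<] p.2)
      (𝓝 (p.1 * u + p.2 * v)) := by
    have : Continuous fun w : ℝ × ℝ => w.1 * u + w.2 * v := by fun_prop
    refine (this.tendsto p).mono_left ?_
    rw [nhds_prod_eq]
    exact Filter.prod_mono nhdsWithin_le_nhds nhdsWithin_le_nhds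
  obtain ⟨P, hP, Q, hQ, hPQ⟩ := eventually_prod_iff.1 (hlim.eventually (lt_mem_nhds h))
  obtain ⟨a, ha, haP⟩ := mem_nhdsLT_iff_exists_Ioo_subset.1 hP
  obtain ⟨b, hb, hbQ⟩ := mem_nhdsLT_iff_exists_Ioo_subset.1 hQ
  obtain ⟨x, hx⟩ := exists_rat_btwn (mem_Iio.1 ha)
  obtain ⟨y, hy⟩ := exists_rat_btwn (mem_Iio.1 hb)
  exact ⟨(x, y), hp.mono hx.2.le hy.2.le, hPQ (haP hx) (hbQ hy)⟩

/-- The extension of `f` to `0` by its limit is a supremum of affine minorants. -/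
theorem exists_isAffineMinorant_of_lt_extendZero {f : ℝ → ℝ} (hf : ConvexOn ℝ (Ioi 0) f)
    (hf1 : f 1 = 0) {t : ℝ≥0∞} (ht : t ≠ ∞) {c : ℝ} (hc : (c : EReal) < extendZero f t) :
    ∃ p, IsAffineMinorant f p ∧ c < p.1 * t.toReal + p.2 := by
  unfold extendZero at hc
  split_ifs at hc with h
  · obtain ⟨c', hcc', hc'⟩ := EReal.lt_iff_exists_real_btwn.1 hc
    have hfreq := frequently_lt_of_lt_limsup (by isBoundedDefault) hc'
    -- Take the supporting line at a small `s`. Since `p.1 + p.2 ≤ f 1 = 0`, an intercept `p.2 ≤ c`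
    -- would give `f s = s * (p.1 + p.2) + (1 - s) * p.2 ≤ c * (1 - s) < c'`.
    have hlim : Tendsto (fun s : ℝ => c * (1 - s)) (𝓝[>] 0) (𝓝 (c * (1 - 0))) :=
      (Continuous.tendsto (by fun_prop) 0).mono_left nhdsWithin_le_nhds
    have hev : ∀ᶠ s : ℝ in 𝓝[>] 0, c * (1 - s) < c' :=
      hlim.eventually (gt_mem_nhds (by simpa using hcc'))
    have hlt : ∀ᶠ s : ℝ in 𝓝[>] 0, 0 < s ∧ s < 1 := by
      filter_upwards [Ioo_mem_nhdsGT (zero_lt_one (α := ℝ))] with s hs using hs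
    obtain ⟨s, hs, hs1, hs2, hs3⟩ := (hfreq.and_eventually (hev.and hlt)).exists
    obtain ⟨p, hp, hps⟩ := exists_isAffineMinorant_eq hf hs2
    refine ⟨p, hp, ?_⟩
    have h1 := hp 1 one_pos
    rw [EReal.coe_lt_coe_iff] at hs
    simp only [h, ENNReal.toReal_zero, mul_zero, zero_add]
    by_contra! hcon
    nlinarith
  · obtain ⟨p, hp, hps⟩ := exists_isAffineMinorant_eq hf (ENNReal.toReal_pos h ht)
    exact ⟨p, hp, by rw [hps]; exact_mod_cast hc⟩

/-- The asymptotic slope of `f` is the supremum of the slopes of its affine minorants. -/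
theorem exists_isAffineMinorant_of_lt_slopeAtTop {f : ℝ → ℝ} (hf : ConvexOn ℝ (Ioi 0) f)
    (hf1 : f 1 = 0) {c : ℝ} (hc : (c : EReal) < slopeAtTop f) :
    ∃ p, IsAffineMinorant f p ∧ c < p.1 := by
  obtain ⟨c', hcc', hc'⟩ := EReal.lt_iff_exists_real_btwn.1 hc
  have hfreq := frequently_lt_of_lt_limsup (by isBoundedDefault) hc'
  -- Likewise at a large `s`: a slope `p.1 ≤ c` would give `f s = (s - 1) * p.1 + (p.1 + p.2) ≤ c *
  -- (s - 1) < c' * s`.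
  have hlim : Tendsto (fun s : ℝ => c * (1 - s⁻¹)) atTop (𝓝 (c * (1 - 0))) :=
    (tendsto_const_nhds.sub tendsto_inv_atTop_zero).const_mul c
  have hev : ∀ᶠ s : ℝ in atTop, c * (1 - s⁻¹) < c' :=
    hlim.eventually (gt_mem_nhds (by simpa using hcc'))
  obtain ⟨s, hs, hs1, hs2⟩ := (hfreq.and_eventually (hev.and (eventually_gt_atTop 1))).exists
  have hs0 : 0 < s := one_pos.trans hs2
  obtain ⟨p, hp, hps⟩ := exists_isAffineMinorant_eq hf hs0
  refine ⟨p, hp, ?_⟩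
  have h1 := hp 1 one_pos
  rw [EReal.coe_lt_coe_iff, lt_div_iff₀ hs0] at hs
  have h2 : c * (s - 1) < c' * s := by
    have := mul_lt_mul_of_pos_right hs1 hs0
    rwa [mul_assoc, sub_mul, inv_mul_cancel₀ hs0.ne', one_mul] at this
  by_contra! hcon
  nlinarith

/-! ### Measurable selection of minorants -/

/-- Among `e 0, …, e n`, a pair `p` that maximizes `p.1 * w.1 + p.2 * w.2`. -/
noncomputable def argmaxPair (e : ℕ → ℝ × ℝ) : ℕ → ℝ × ℝ → ℝ × ℝ
  | 0, _ => e 0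
  | n + 1, w =>
    if (argmaxPair e n w).1 * w.1 + (argmaxPair e n w).2 * w.2
        < (e (n + 1)).1 * w.1 + (e (n + 1)).2 * w.2 then e (n + 1) else argmaxPair e n w

theorem measurable_argmaxPair (e : ℕ → ℝ × ℝ) (n : ℕ) : Measurable (argmaxPair e n) := by
  induction n with
  | zero => exact measurable_const
  | succ n ih =>
    refine Measurable.ite (measurableSet_lt ?_ ?_) measurable_const ih <;> fun_prop

theorem argmaxPair_mem_range (e : ℕ → ℝ × ℝ) (n : ℕ) (w : ℝ × ℝ) :
    ∃ i ≤ n, argmaxPair e n w = e i := by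
  induction n with
  | zero => exact ⟨0, le_rfl, rfl⟩
  | succ n ih =>
    obtain ⟨i, hi, h⟩ := ih
    by_cases hlt : (argmaxPair e n w).1 * w.1 + (argmaxPair e n w).2 * w.2
        < (e (n + 1)).1 * w.1 + (e (n + 1)).2 * w.2
    · exact ⟨n + 1, le_rfl, if_pos hlt⟩
    · exact ⟨i, hi.trans n.le_succ, (if_neg hlt).trans h⟩

/-- The value attained by `argmaxPair`. -/
noncomputable def maxPairing (e : ℕ → ℝ × ℝ) (n : ℕ) (w : ℝ × ℝ) : ℝ :=
  (argmaxPair e n w).1 * w.1 + (argmaxPair e n w).2 * w.2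

theorem maxPairing_succ (e : ℕ → ℝ × ℝ) (n : ℕ) (w : ℝ × ℝ) :
    maxPairing e (n + 1) w
      = max (maxPairing e n w) ((e (n + 1)).1 * w.1 + (e (n + 1)).2 * w.2) := by
  unfold maxPairing
  rw [argmaxPair]
  split_ifs with h
  · exact (max_eq_right h.le).symm
  · exact (max_eq_left (not_lt.1 h)).symm

theorem monotone_maxPairing (e : ℕ → ℝ × ℝ) (w : ℝ × ℝ) : Monotone fun n => maxPairing e n w :=
  monotone_nat_of_le_succ fun n => (le_max_left _ _).trans_eq (maxPairing_succ e n w).symm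

theorem le_maxPairing (e : ℕ → ℝ × ℝ) (n : ℕ) (w : ℝ × ℝ) :
    (e n).1 * w.1 + (e n).2 * w.2 ≤ maxPairing e n w := by
  cases n with
  | zero => exact le_rfl
  | succ n => exact (le_max_right _ _).trans_eq (maxPairing_succ e n w).symm

theorem tendsto_maxPairing {e : ℕ → ℝ × ℝ} {w : ℝ × ℝ} {y : EReal}
    (hle : ∀ i, (((e i).1 * w.1 + (e i).2 * w.2 : ℝ) : EReal) ≤ y)
    (hlt : ∀ c : ℝ, (c : EReal) < y → ∃ i, c < (e i).1 * w.1 + (e i).2 * w.2) :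
    Tendsto (fun n => (maxPairing e n w : EReal)) atTop (𝓝 y) := by
  refine tendsto_atTop_isLUB
    (fun m n h => EReal.coe_le_coe_iff.2 (monotone_maxPairing e w h)) ⟨?_, fun z hz => ?_⟩
  · rintro _ ⟨n, rfl⟩
    obtain ⟨i, -, hi⟩ := argmaxPair_mem_range e n w
    simpa only [maxPairing, hi] using hle i
  · refine EReal.le_of_forall_lt_iff_le.1 fun c hc => ?_
    by_contra! hcon
    obtain ⟨i, hi⟩ := hlt c hcon
    have h1 : (maxPairing e i w : EReal) ≤ z := hz ⟨i, rfl⟩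
    have h2 : (c : EReal) < maxPairing e i w :=
      EReal.coe_lt_coe_iff.2 (hi.trans_le (le_maxPairing e i w))
    exact absurd (h2.trans_le h1) (not_lt.2 hc.le)

/-- A sequence of affine minorants that approximates `f`, also at `0` and at `∞`. -/
theorem exists_seq_isAffineMinorant {f : ℝ → ℝ} (hf : ConvexOn ℝ (Ioi 0) f) (hf1 : f 1 = 0) :
    ∃ e : ℕ → ℝ × ℝ, (∀ n, IsAffineMinorant f (e n)) ∧
      (∀ t : ℝ≥0∞, t ≠ ∞ →
        Tendsto (fun n => (maxPairing e n (t.toReal, 1) : EReal)) atTop (𝓝 (extendZero f t))) ∧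
      Tendsto (fun n => (maxPairing e n (1, 0) : EReal)) atTop (𝓝 (slopeAtTop f)) := by
  have hne : {q : ℚ × ℚ | IsAffineMinorant f (q.1, q.2)}.Nonempty := by
    obtain ⟨p, hp, -⟩ := exists_isAffineMinorant_eq hf one_pos
    obtain ⟨q, hq, -⟩ := exists_isAffineMinorant_rat_lt hp (u := 0) (v := 0) (c := -1) (by simp)
    exact ⟨q, hq⟩
  obtain ⟨g, hg⟩ := (to_countable {q : ℚ × ℚ | IsAffineMinorant f (q.1, q.2)}).exists_eq_range hne
  have hmin : ∀ n, IsAffineMinorant f ((g n).1, (g n).2) := fun n =>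
    (hg ▸ mem_range_self n : g n ∈ {q : ℚ × ℚ | IsAffineMinorant f (q.1, q.2)})
  have hex : ∀ p, IsAffineMinorant f p → ∀ u v c : ℝ, c < p.1 * u + p.2 * v →
      ∃ i, c < ((g i).1 : ℝ) * u + ((g i).2 : ℝ) * v := by
    intro p hp u v c hc
    obtain ⟨q, hq, hqc⟩ := exists_isAffineMinorant_rat_lt hp hc
    have : q ∈ range g := hg ▸ hq
    obtain ⟨i, rfl⟩ := this
    exact ⟨i, hqc⟩
  -- Pairing with `(t, 1)` evaluates a line at `t`; pairing with `(1, 0)` extracts its slope. One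
  -- enumeration thus serves both limits.
  refine ⟨fun n => ((g n).1, (g n).2), hmin, fun t ht => ?_, ?_⟩
  · refine tendsto_maxPairing (fun i => ?_) fun c hc => ?_
    · simpa using (hmin i).le_extendZero ht
    · obtain ⟨p, hp, hpc⟩ := exists_isAffineMinorant_of_lt_extendZero hf hf1 ht hc
      exact hex p hp _ _ c (by simpa using hpc)
  · refine tendsto_maxPairing (fun i => ?_) fun c hc => ?_
    · simpa using (hmin i).le_slopeAtTop
    · obtain ⟨p, hp, hpc⟩ := exists_isAffineMinorant_of_lt_slopeAtTop hf hf1 hc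
      exact hex p hp _ _ c (by simpa using hpc)

/-! ### The variational formula -/

/-- The integral of an extended-real function with an integrable minorant `l`, as the integral
of a nonnegative function plus that of `l`. -/
theorem lintegral_toENNReal_sub_eq {O : Type*} [MeasurableSpace O] {ν : Measure O}
    {h : O → EReal} {l : O → ℝ} (hh : AEMeasurable h ν) (hl : Integrable l ν)
    (hle : ∀ᵐ x ∂ν, (l x : EReal) ≤ h x) :
    ((∫⁻ x, (h x).toENNReal ∂ν : ℝ≥0∞) : EReal) - ((∫⁻ x, (-h x).toENNReal ∂ν : ℝ≥0∞) : EReal)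
      = ((∫⁻ x, (h x - l x).toENNReal ∂ν : ℝ≥0∞) : EReal) + ((∫ x, l x ∂ν : ℝ) : EReal) := by
  have hlm : AEMeasurable l ν := hl.aemeasurable
  -- This is `h = (h - l) + l` with negative parts moved across, so that it also holds where `h =
  -- ⊤`.
  have hpt : ∀ᵐ x ∂ν, (h x - l x).toENNReal + (-h x).toENNReal + ENNReal.ofReal (l x)
      = (h x).toENNReal + ENNReal.ofReal (-l x) := by
    filter_upwards [hle] with x hx
    generalize h x = y at hx
    induction y with
    | bot => simp at hx
    | top => simp
    | coe y =>
      rw [EReal.coe_le_coe_iff] at hx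
      rw [← EReal.coe_sub, ← EReal.coe_neg]
      simp only [EReal.real_coe_toENNReal]
      rw [← ENNReal.toReal_eq_toReal_iff' (by simp) (by simp)]
      simp only [ENNReal.toReal_add, ENNReal.toReal_ofReal', ne_eq, ENNReal.ofReal_ne_top,
        not_false_eq_true, ENNReal.add_eq_top, or_self]
      grind
  have hint := lintegral_congr_ae hpt
  have hsub : AEMeasurable (fun x => (h x - l x).toENNReal) ν :=
    (hh.sub hlm.coe_real_ereal).ereal_toENNReal
  rw [lintegral_add_right' _ hlm.ennreal_ofReal, lintegral_add_left' hsub,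
    lintegral_add_right' _ hlm.fun_neg.ennreal_ofReal] at hint
  have hneg : ∫⁻ x, (-h x).toENNReal ∂ν ≤ ∫⁻ x, ENNReal.ofReal (-l x) ∂ν := by
    refine lintegral_mono_ae ?_
    filter_upwards [hle] with x hx
    rw [← EReal.real_coe_toENNReal, EReal.coe_neg]
    exact EReal.toENNReal_le_toENNReal (EReal.neg_le_neg_iff.2 hx)
  have hfin : ∫⁻ x, ENNReal.ofReal (l x) ∂ν ≠ ∞ := hl.lintegral_lt_top.ne
  have hfin' : ∫⁻ x, ENNReal.ofReal (-l x) ∂ν ≠ ∞ := hl.neg.lintegral_lt_top.ne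
  have hnegfin := ne_top_of_le_ne_top hfin' hneg
  rw [integral_eq_lintegral_pos_part_sub_lintegral_neg_part hl]
  generalize ∫⁻ x, (-h x).toENNReal ∂ν = N at *
  generalize ∫⁻ x, (h x).toENNReal ∂ν = P at *
  generalize ∫⁻ x, (h x - l x).toENNReal ∂ν = Q at *
  generalize ∫⁻ x, ENNReal.ofReal (l x) ∂ν = lp at *
  generalize ∫⁻ x, ENNReal.ofReal (-l x) ∂ν = ln at *
  lift N to NNReal using hnegfin
  lift lp to NNReal using hfin
  lift ln to NNReal using hfin'
  induction Q with
  | top =>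
    have : P = ∞ := by simpa using hint.symm
    subst this
    simp only [ENNReal.coe_toReal, EReal.coe_ennreal_top, EReal.top_add_coe]
    exact EReal.top_sub_coe (N : ℝ)
  | coe Q =>
    have : P ≠ ∞ := by
      rintro rfl
      simp at hint
    lift P to NNReal using this
    have hint' : (Q : ℝ) + N + lp = P + ln := by exact_mod_cast hint
    have : (P : ℝ) - N = Q + (lp - ln) := by linarith
    have := congrArg Real.toEReal this
    rwa [EReal.coe_sub, EReal.coe_add] at this

/-- A bounded measurable choice of affine minorants of `f`. -/
structure IsMinorantField {O : Type*} [MeasurableSpace O] (f : ℝ → ℝ) (a b : O → ℝ) : Prop where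
  measurable_fst : Measurable a
  measurable_snd : Measurable b
  bounded_fst : ∃ C, ∀ x, ‖a x‖ ≤ C
  bounded_snd : ∃ C, ∀ x, ‖b x‖ ≤ C
  isAffineMinorant : ∀ x, IsAffineMinorant f (a x, b x)

section

variable {O : Type*} [MeasurableSpace O] {f : ℝ → ℝ} {a b : O → ℝ}

theorem integrable_of_measurable_of_bounded (ha : Measurable a) (hC : ∃ C, ∀ x, ‖a x‖ ≤ C)
    (μ : Measure O) [IsFiniteMeasure μ] : Integrable a μ :=
  hC.elim fun C h => .of_bound ha.aestronglyMeasurable C (ae_of_all _ h)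

theorem IsMinorantField.integrable_fst (h : IsMinorantField f a b) (μ : Measure O)
    [IsFiniteMeasure μ] : Integrable a μ :=
  integrable_of_measurable_of_bounded h.measurable_fst h.bounded_fst μ

theorem IsMinorantField.integrable_snd (h : IsMinorantField f a b) (μ : Measure O)
    [IsFiniteMeasure μ] : Integrable b μ :=
  integrable_of_measurable_of_bounded h.measurable_snd h.bounded_snd μ

theorem IsMinorantField.integrable_density (h : IsMinorantField f a b) (μ ν : Measure O)
    [IsFiniteMeasure μ] [IsFiniteMeasure ν] :
    Integrable (fun x => a x * (μ.rnDeriv ν x).toReal + b x) ν :=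
  (Measure.integrable_toReal_rnDeriv.bdd_mul h.measurable_fst.aestronglyMeasurable
    (ae_of_all _ h.bounded_fst.choose_spec)).add (h.integrable_snd ν)

theorem IsMinorantField.integral_add_integral (h : IsMinorantField f a b) (μ ν : Measure O)
    [IsFiniteMeasure μ] [IsFiniteMeasure ν] :
    ∫ x, a x ∂μ + ∫ x, b x ∂ν
      = ∫ x, (a x * (μ.rnDeriv ν x).toReal + b x) ∂ν + ∫ x, a x ∂(μ.singularPart ν) := by
  have hmul : Integrable (fun x => a x * (μ.rnDeriv ν x).toReal) ν :=
    Measure.integrable_toReal_rnDeriv.bdd_mul h.measurable_fst.aestronglyMeasurable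
      (ae_of_all _ h.bounded_fst.choose_spec)
  have hμ : ∫ x, a x ∂μ
      = ∫ x, a x ∂(μ.singularPart ν) + ∫ x, a x * (μ.rnDeriv ν x).toReal ∂ν := by
    conv_lhs => rw [← Measure.singularPart_add_rnDeriv μ ν]
    rw [integral_add_measure (h.integrable_fst _) (h.integrable_fst _),
      integral_withDensity_eq_integral_toReal_smul (Measure.measurable_rnDeriv μ ν)
        (Measure.rnDeriv_lt_top μ ν)]
    simp only [smul_eq_mul, mul_comm]
  rw [hμ, integral_add hmul (h.integrable_snd ν)]
  ring

/-- The function is an a.e. limit of finite maxima of affine functions of the density. -/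
theorem aemeasurable_extendZero_rnDeriv (hf : ConvexOn ℝ (Ioi 0) f) (hf1 : f 1 = 0)
    (μ ν : Measure O) [IsFiniteMeasure μ] :
    AEMeasurable (fun x => extendZero f (μ.rnDeriv ν x)) ν := by
  obtain ⟨e, -, he, -⟩ := exists_seq_isAffineMinorant hf hf1
  refine aemeasurable_of_tendsto_metrizable_ae (u := atTop)
    (f := fun n x => (maxPairing e n ((μ.rnDeriv ν x).toReal, 1) : EReal)) (fun n => ?_) ?_
  · have := measurable_argmaxPair e n
    have := Measure.measurable_rnDeriv μ ν
    unfold maxPairing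
    fun_prop
  · filter_upwards [μ.rnDeriv_ne_top ν] with x hx using he _ hx

/-- Every bounded measurable choice of affine minorants bounds the divergence from below. -/
theorem IsMinorantField.le_fDiv (h : IsMinorantField f a b) (hf : ConvexOn ℝ (Ioi 0) f)
    (hf1 : f 1 = 0) (μ ν : Measure O) [IsFiniteMeasure μ] [IsFiniteMeasure ν] :
    ((∫ x, a x ∂μ + ∫ x, b x ∂ν : ℝ) : EReal) ≤ fDiv f μ ν := by
  rw [h.integral_add_integral μ ν, EReal.coe_add, fDiv]
  refine add_le_add ?_ ?_
  · rw [lintegral_toENNReal_sub_eq (aemeasurable_extendZero_rnDeriv hf hf1 μ ν)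
      (h.integrable_density μ ν)]
    · exact le_add_of_nonneg_left (EReal.coe_ennreal_nonneg _)
    · filter_upwards [μ.rnDeriv_ne_top ν] with x hx using
        (h.isAffineMinorant x).le_extendZero hx
  · have hm : ((μ.singularPart ν univ : ℝ≥0∞) : EReal) = (((μ.singularPart ν).real univ : ℝ)) := by
      rw [Measure.real, EReal.coe_ennreal_toReal (measure_ne_top _ _)]
    have hslope : ∀ x, (a x : EReal) ≤ slopeAtTop f := fun x =>
      (h.isAffineMinorant x).le_slopeAtTop
    rw [hm]
    generalize slopeAtTop f = s at hslope
    -- Positive singular mass makes the product `⊤` when the slope is `⊤`, and provides a point of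
    -- `O` that excludes slope `⊥`.
    rcases eq_or_ne (μ.singularPart ν) 0 with h0 | h0
    · simp [h0]
    have : Nonempty O :=
      (nonempty_of_measure_ne_zero (Measure.measure_univ_ne_zero.2 h0)).to_type
    have hpos : 0 < (μ.singularPart ν).real univ :=
      ENNReal.toReal_pos (Measure.measure_univ_ne_zero.2 h0) (measure_ne_top _ _)
    induction s with
    | bot => simpa using hslope this.some
    | top => rw [EReal.top_mul_coe_of_pos hpos]; exact le_top
    | coe s =>
      rw [← EReal.coe_mul, EReal.coe_le_coe_iff]
      calc ∫ x, a x ∂(μ.singularPart ν) ≤ ∫ _, s ∂(μ.singularPart ν) :=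
            integral_mono (h.integrable_fst _) (integrable_const _)
              fun x => EReal.coe_le_coe_iff.1 (hslope x)
        _ = s * (μ.singularPart ν).real univ := by
            rw [integral_const, smul_eq_mul, mul_comm]

/-- The divergence is the least upper bound of the bounds given by bounded measurable choices of
affine minorants. -/
theorem fDiv_le_of_forall_isMinorantField (hf : ConvexOn ℝ (Ioi 0) f) (hf1 : f 1 = 0)
    (μ ν : Measure O) [IsFiniteMeasure μ] [IsFiniteMeasure ν] {c : EReal}
    (hc : ∀ a b : O → ℝ, IsMinorantField f a b →
      ((∫ x, a x ∂μ + ∫ x, b x ∂ν : ℝ) : EReal) ≤ c) :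
    fDiv f μ ν ≤ c := by
  classical
  obtain ⟨e, hmin, he, hslope⟩ := exists_seq_isAffineMinorant hf hf1
  have hsing : μ.singularPart ν ⟂ₘ ν := Measure.mutuallySingular_singularPart μ ν
  let s := hsing.nullSet
  have hs : MeasurableSet s := hsing.measurableSet_nullSet
  have hs_ae : ∀ᵐ x ∂(μ.singularPart ν), x ∉ s :=
    measure_eq_zero_iff_ae_notMem.1 hsing.measure_nullSet
  have hs_ae' : ∀ᵐ x ∂ν, x ∈ s := by
    filter_upwards [measure_eq_zero_iff_ae_notMem.1 hsing.measure_compl_nullSet] with x hx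
    simpa using hx
  -- `ν` lives on `s` and the singular part off `s`, so the selection can maximize the value at the
  -- density on `s` and the slope off `s`.
  let w : O → ℝ × ℝ := fun x => if x ∈ s then ((μ.rnDeriv ν x).toReal, 1) else (1, 0)
  have hw : Measurable w := Measurable.ite hs
    ((Measure.measurable_rnDeriv μ ν).ennreal_toReal.prodMk measurable_const) measurable_const
  let p : ℕ → O → ℝ × ℝ := fun n x => argmaxPair e n (w x)
  have hp : ∀ n, Measurable (p n) := fun n => (measurable_argmaxPair e n).comp hw
  have hbdd : ∀ n, ∃ C, ∀ x, ‖p n x‖ ≤ C := fun n =>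
    ⟨∑ i ∈ Finset.range (n + 1), ‖e i‖, fun x => by
      obtain ⟨i, hi, hix⟩ := argmaxPair_mem_range e n (w x)
      simp only [p, hix]
      exact Finset.single_le_sum (f := fun i => ‖e i‖) (fun _ _ => norm_nonneg _)
        (Finset.mem_range.2 (Nat.lt_succ_of_le hi))⟩
  have hfield : ∀ n, IsMinorantField f (fun x => (p n x).1) (fun x => (p n x).2) := fun n =>
    { measurable_fst := (hp n).fst
      measurable_snd := (hp n).snd
      bounded_fst := (hbdd n).imp fun C hC x => (norm_fst_le _).trans (hC x)
      bounded_snd := (hbdd n).imp fun C hC x => (norm_snd_le _).trans (hC x)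
      isAffineMinorant := fun x => by
        obtain ⟨i, -, hi⟩ := argmaxPair_mem_range e n (w x)
        simpa only [p, hi] using hmin i }
  let G : ℕ → O → ℝ := fun n x => maxPairing e n ((μ.rnDeriv ν x).toReal, 1)
  have hG : ∀ n, (fun x => (p n x).1 * (μ.rnDeriv ν x).toReal + (p n x).2) =ᵐ[ν] G n := by
    intro n
    filter_upwards [hs_ae'] with x hx
    simp [G, p, w, maxPairing, hx]
  have hGint : ∀ n, Integrable (G n) ν := fun n =>
    ((hfield n).integrable_density μ ν).congr (hG n)
  have hval : ∀ n, ∫ x, (p n x).1 ∂μ + ∫ x, (p n x).2 ∂ν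
      = ∫ x, G n x ∂ν + maxPairing e n (1, 0) * (μ.singularPart ν).real univ := by
    intro n
    have hconst : (fun x => (p n x).1) =ᵐ[μ.singularPart ν] fun _ => maxPairing e n (1, 0) := by
      filter_upwards [hs_ae] with x hx
      simp [p, w, maxPairing, hx]
    rw [(hfield n).integral_add_integral μ ν, integral_congr_ae (hG n), integral_congr_ae hconst,
      integral_const, smul_eq_mul, mul_comm (maxPairing e n (1, 0))]
  have hGmono : ∀ x, Monotone fun n => G n x := fun x => monotone_maxPairing e _
  have hGlim : ∀ᵐ x ∂ν, Tendsto (fun n => (G n x : EReal)) atTop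
      (𝓝 (extendZero f (μ.rnDeriv ν x))) := by
    filter_upwards [μ.rnDeriv_ne_top ν] with x hx using he _ hx
  have hlim₁ : Tendsto (fun n => ((∫ x, G n x ∂ν : ℝ) : EReal)) atTop
      (𝓝 (((∫⁻ x, (extendZero f (μ.rnDeriv ν x)).toENNReal ∂ν : ℝ≥0∞) : EReal)
        - ((∫⁻ x, (-extendZero f (μ.rnDeriv ν x)).toENNReal ∂ν : ℝ≥0∞) : EReal))) := by
    have hle : ∀ᵐ x ∂ν, (G 0 x : EReal) ≤ extendZero f (μ.rnDeriv ν x) := by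
      filter_upwards [hGlim] with x hx
      exact (EReal.coe_strictMono.monotone.comp (hGmono x)).ge_of_tendsto hx 0
    -- Subtracting the integrable `G 0` makes the increasing sequence nonnegative, ready for
    -- monotone convergence.
    rw [lintegral_toENNReal_sub_eq (aemeasurable_extendZero_rnDeriv hf hf1 μ ν) (hGint 0) hle]
    have hsplit : ∀ n, ((∫ x, G n x ∂ν : ℝ) : EReal)
        = ((∫⁻ x, ENNReal.ofReal (G n x - G 0 x) ∂ν : ℝ≥0∞) : EReal)
          + ((∫ x, G 0 x ∂ν : ℝ) : EReal) := by
      intro n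
      have hnn : 0 ≤ᵐ[ν] fun x => G n x - G 0 x :=
        ae_of_all _ fun x => sub_nonneg.2 (hGmono x n.zero_le)
      have hsub : Integrable (fun x => G n x - G 0 x) ν := (hGint n).sub (hGint 0)
      rw [← ofReal_integral_eq_lintegral_ofReal hsub hnn,
        EReal.coe_ennreal_ofReal, max_eq_left (integral_nonneg_of_ae hnn), ← EReal.coe_add,
        integral_sub (hGint n) (hGint 0), sub_add_cancel]
    rw [funext hsplit]
    have hmct : Tendsto (fun n => ∫⁻ x, ENNReal.ofReal (G n x - G 0 x) ∂ν) atTop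
        (𝓝 (∫⁻ x, (extendZero f (μ.rnDeriv ν x) - G 0 x).toENNReal ∂ν)) := by
      refine lintegral_tendsto_of_tendsto_of_monotone
        (fun n => ((hGint n).sub (hGint 0)).aemeasurable.ennreal_ofReal) ?_ ?_
      · exact ae_of_all _ fun x m n hmn =>
          ENNReal.ofReal_le_ofReal (sub_le_sub_right (hGmono x hmn) _)
      · filter_upwards [hGlim] with x hx
        have hsub : Tendsto (fun n => (G n x : EReal) + (-G 0 x : ℝ)) atTop
            (𝓝 (extendZero f (μ.rnDeriv ν x) + (-G 0 x : ℝ))) :=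
          (EReal.continuousAt_add (p := (_, ((-G 0 x : ℝ) : EReal)))
            (Or.inr (EReal.coe_ne_bot _)) (Or.inr (EReal.coe_ne_top _))).tendsto.comp
            (hx.prodMk_nhds tendsto_const_nhds)
        have := (EReal.continuous_toENNReal.tendsto _).comp hsub
        simp only [Function.comp_def, EReal.coe_neg, ← sub_eq_add_neg, ← EReal.coe_sub] at this
        exact this
    exact (EReal.continuousAt_add (p := (_, ((∫ x, G 0 x ∂ν : ℝ) : EReal)))
      (Or.inr (EReal.coe_ne_bot _)) (Or.inr (EReal.coe_ne_top _))).tendsto.comp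
      (((continuous_coe_ennreal_ereal.tendsto _).comp hmct).prodMk_nhds tendsto_const_nhds)
  have hm : ((μ.singularPart ν univ : ℝ≥0∞) : EReal) = (((μ.singularPart ν).real univ : ℝ)) := by
    rw [Measure.real, EReal.coe_ennreal_toReal (measure_ne_top _ _)]
  have hlim₂ : Tendsto
      (fun n => (maxPairing e n (1, 0) : EReal) * ((μ.singularPart ν univ : ℝ≥0∞) : EReal)) atTop
      (𝓝 (slopeAtTop f * ((μ.singularPart ν univ : ℝ≥0∞) : EReal))) := by
    rw [hm]
    exact EReal.Tendsto.mul_const hslope (Or.inr (EReal.coe_ne_bot _)) (Or.inr (EReal.coe_ne_top _))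
  -- Addition on `EReal` is discontinuous at `⊤ + ⊥`; that neither limit is `⊥` rules this out.
  have hne₁ : ((∫⁻ x, (extendZero f (μ.rnDeriv ν x)).toENNReal ∂ν : ℝ≥0∞) : EReal)
        - ((∫⁻ x, (-extendZero f (μ.rnDeriv ν x)).toENNReal ∂ν : ℝ≥0∞) : EReal) ≠ ⊥ := by
    refine ne_bot_of_le_ne_bot (EReal.coe_ne_bot (∫ x, G 0 x ∂ν)) ?_
    refine Monotone.ge_of_tendsto (fun m n hmn => ?_) hlim₁ 0
    exact EReal.coe_le_coe_iff.2 (integral_mono (hGint m) (hGint n) fun x => hGmono x hmn)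
  have hne₂ : slopeAtTop f * ((μ.singularPart ν univ : ℝ≥0∞) : EReal) ≠ ⊥ := by
    rw [hm] at hlim₂ ⊢
    refine ne_bot_of_le_ne_bot (EReal.coe_ne_bot
      (maxPairing e 0 (1, 0) * (μ.singularPart ν).real univ)) ?_
    rw [EReal.coe_mul]
    exact mul_le_mul_of_nonneg_right (by simpa [maxPairing, argmaxPair] using (hmin 0).le_slopeAtTop)
      (EReal.coe_nonneg.2 measureReal_nonneg)
  have hlim := (EReal.continuousAt_add (p := (_, _)) (Or.inr hne₂) (Or.inl hne₁)).tendsto.comp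
    (hlim₁.prodMk_nhds hlim₂)
  refine le_of_tendsto' hlim fun n => ?_
  have := hc _ _ (hfield n)
  rw [hval n, EReal.coe_add, EReal.coe_mul, ← hm] at this
  exact this

end

/-! ### Behaviour under kernels and mixtures -/

theorem integral_kernel_comp {O O' : Type*} [MeasurableSpace O] [MeasurableSpace O']
    (κ : Kernel O O') [IsMarkovKernel κ] (μ : Measure O) [IsFiniteMeasure μ] {a : O' → ℝ}
    (ha : Integrable a (κ ∘ₘ μ)) : ∫ y, a y ∂(κ ∘ₘ μ) = ∫ x, ∫ y, a y ∂(κ x) ∂μ :=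
  Kernel.integral_comp (κ := Kernel.const Unit μ) (η := κ) (a := ()) ha

/-- Integrating `a y * t + b y ≤ f t` over the probability measure `κ x` leaves the right side
unchanged, since it does not depend on `y`. -/
theorem IsMinorantField.comp_kernel {O O' : Type*} [MeasurableSpace O] [MeasurableSpace O']
    {f : ℝ → ℝ} {a b : O' → ℝ} (h : IsMinorantField f a b) (κ : Kernel O O') [IsMarkovKernel κ] :
    IsMinorantField f (fun x => ∫ y, a y ∂(κ x)) (fun x => ∫ y, b y ∂(κ x)) where
  measurable_fst := h.measurable_fst.stronglyMeasurable.integral_kernel.measurable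
  measurable_snd := h.measurable_snd.stronglyMeasurable.integral_kernel.measurable
  bounded_fst := h.bounded_fst.imp fun C hC x => by
    simpa using norm_integral_le_of_norm_le_const (μ := κ x) (ae_of_all _ hC)
  bounded_snd := h.bounded_snd.imp fun C hC x => by
    simpa using norm_integral_le_of_norm_le_const (μ := κ x) (ae_of_all _ hC)
  isAffineMinorant x t ht := by
    have ha := h.integrable_fst (κ x)
    have hb := h.integrable_snd (κ x)
    calc (∫ y, a y ∂(κ x)) * t + ∫ y, b y ∂(κ x) = ∫ y, (a y * t + b y) ∂(κ x) := by
          rw [integral_add (ha.mul_const t) hb, integral_mul_const]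
      _ ≤ ∫ _, f t ∂(κ x) := integral_mono ((ha.mul_const t).add hb) (integrable_const _)
          fun y => h.isAffineMinorant y t ht
      _ = f t := by simp

/-- Data processing inequality. -/
theorem fDiv_comp_le {O O' : Type*} [MeasurableSpace O] [MeasurableSpace O'] {f : ℝ → ℝ}
    (hf : ConvexOn ℝ (Ioi 0) f) (hf1 : f 1 = 0) (κ : Kernel O O') [IsMarkovKernel κ]
    (μ ν : Measure O) [IsFiniteMeasure μ] [IsFiniteMeasure ν] :
    fDiv f (κ ∘ₘ μ) (κ ∘ₘ ν) ≤ fDiv f μ ν := by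
  refine fDiv_le_of_forall_isMinorantField hf hf1 _ _ fun a b h => ?_
  rw [integral_kernel_comp κ μ (h.integrable_fst _), integral_kernel_comp κ ν (h.integrable_snd _)]
  exact (h.comp_kernel κ).le_fDiv hf hf1 μ ν

/-- Joint quasiconvexity of the divergence. -/
theorem fDiv_mix_le {O : Type*} [MeasurableSpace O] {f : ℝ → ℝ}
    (hf : ConvexOn ℝ (Ioi 0) f) (hf1 : f 1 = 0) {p : ℝ} (hp : p ∈ Icc (0 : ℝ) 1)
    (μ₁ μ₂ ν₁ ν₂ : Measure O) [IsFiniteMeasure μ₁] [IsFiniteMeasure μ₂] [IsFiniteMeasure ν₁]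
    [IsFiniteMeasure ν₂] {c : EReal} (h₁ : fDiv f μ₁ ν₁ ≤ c) (h₂ : fDiv f μ₂ ν₂ ≤ c) :
    fDiv f (ENNReal.ofReal p • μ₁ + ENNReal.ofReal (1 - p) • μ₂)
      (ENNReal.ofReal p • ν₁ + ENNReal.ofReal (1 - p) • ν₂) ≤ c := by
  have hfin : ∀ (q : ℝ) (ρ : Measure O) [IsFiniteMeasure ρ],
      IsFiniteMeasure (ENNReal.ofReal q • ρ) := fun q ρ _ => ρ.smul_finite ENNReal.ofReal_ne_top
  have hint : ∀ (ρ σ : Measure O) [IsFiniteMeasure ρ] [IsFiniteMeasure σ] (a : O → ℝ),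
      (∀ τ : Measure O, IsFiniteMeasure τ → Integrable a τ) →
      ∫ x, a x ∂(ENNReal.ofReal p • ρ + ENNReal.ofReal (1 - p) • σ)
        = p * ∫ x, a x ∂ρ + (1 - p) * ∫ x, a x ∂σ := by
    intro ρ σ _ _ a ha
    rw [integral_add_measure (ha _ (hfin _ _)) (ha _ (hfin _ _)), integral_smul_measure,
      integral_smul_measure, ENNReal.toReal_ofReal hp.1, ENNReal.toReal_ofReal (sub_nonneg.2 hp.2),
      smul_eq_mul, smul_eq_mul]
  have := hfin p
  have := hfin (1 - p)
  refine fDiv_le_of_forall_isMinorantField hf hf1 _ _ fun a b h => ?_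
  -- The same field bounds both divergences from below; the mixture's value is the `p`-average of
  -- the two.
  have k₁ := (h.le_fDiv hf hf1 μ₁ ν₁).trans h₁
  have k₂ := (h.le_fDiv hf hf1 μ₂ ν₂).trans h₂
  rw [hint _ _ a fun τ _ => h.integrable_fst τ, hint _ _ b fun τ _ => h.integrable_snd τ]
  induction c with
  | bot => simp at k₁
  | top => exact le_top
  | coe c =>
    rw [EReal.coe_le_coe_iff] at k₁ k₂ ⊢
    have h₃ := mul_le_mul_of_nonneg_left k₁ hp.1
    have h₄ := mul_le_mul_of_nonneg_left k₂ (sub_nonneg.2 hp.2)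
    linarith

/-! ### The axioms for `d`-privacy -/

theorem postProcessingAxiom_dPrivacy {𝒟 : Type v} (d : 𝒟 → 𝒟 → EReal) :
    PostProcessingAxiom (DPrivacy.{u, v} d) := by
  intro O O' _ _ M κ _ hM D₁ D₂ hd S hS
  -- As an inequality of measures, the hypothesis can be integrated against `x ↦ κ x S`.
  have hle : (M D₁ : Measure O) ≤ EReal.exp (d D₁ D₂) • (M D₂ : Measure O) :=
    Measure.le_iff.2 fun T hT => hM D₁ D₂ hd T hT
  change (κ ∘ₘ (M D₁ : Measure O)) S ≤ _ * (κ ∘ₘ (M D₂ : Measure O)) S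
  rw [Measure.bind_apply hS κ.aemeasurable, Measure.bind_apply hS κ.aemeasurable]
  exact (lintegral_mono' hle le_rfl).trans_eq (lintegral_smul_measure _ _)

theorem convexityAxiom_dPrivacy {𝒟 : Type v} (d : 𝒟 → 𝒟 → EReal) :
    ConvexityAxiom (DPrivacy.{u, v} d) := by
  intro O _ M₁ M₂ p hp h₁ h₂ D₁ D₂ hd S hS
  change (ENNReal.ofReal p • (M₁ D₁ : Measure O) + ENNReal.ofReal (1 - p) • (M₂ D₁ : Measure O)) S
    ≤ _ * (ENNReal.ofReal p • (M₁ D₂ : Measure O)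
      + ENNReal.ofReal (1 - p) • (M₂ D₂ : Measure O)) S
  simp only [Measure.add_apply, Measure.smul_apply, smul_eq_mul]
  rw [mul_add, mul_left_comm, mul_left_comm _ (ENNReal.ofReal (1 - p))]
  gcongr
  · exact h₁ D₁ D₂ hd S hS
  · exact h₂ D₁ D₂ hd S hS

end Privacy

theorem mainTheorem3 {𝒟 : Type v} (d : 𝒟 → 𝒟 → EReal) :
    (Privacy.PostProcessingAxiom (Privacy.DPrivacy.{u, v} d) ∧
      Privacy.ConvexityAxiom (Privacy.DPrivacy.{u, v} d)) ∧
    ∀ f : ℝ → ℝ, ConvexOn ℝ (Set.Ioi 0) f → f 1 = 0 →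
      Privacy.PostProcessingAxiom (Privacy.ExtendedDivergenceDP.{u, v} f d) ∧
      Privacy.ConvexityAxiom (Privacy.ExtendedDivergenceDP.{u, v} f d) := by
  refine ⟨⟨Privacy.postProcessingAxiom_dPrivacy d, Privacy.convexityAxiom_dPrivacy d⟩,
    fun f hf hf1 => ⟨?_, ?_⟩⟩
  · intro O O' _ _ M κ _ hM D₁ D₂
    exact (Privacy.fDiv_comp_le hf hf1 κ _ _).trans (hM D₁ D₂)
  · intro O _ M₁ M₂ p hp h₁ h₂ D₁ D₂
    exact Privacy.fDiv_mix_le hf hf1 hp _ _ _ _ (h₁ D₁ D₂) (h₂ D₁ D₂)
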